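/- Let $R$ be a commutative ring with $1$ and let $(A,B,M,N,\Phi,\Psi)$ be a Morita context over $R$: $A,B$ are unital $R$-algebras, $M$ is an $(A,B)$-bimodule, $N$ is a $(B,A)$-bimodule (actions unital and compatible with $R$), and $\Phi:M\otimes_B N\to A$, $\Psi:N\otimes_A M\to B$ are bimodule homomorphisms such that, writing $mn=\Phi(m\otimes n)$ and $nm=\Psi(n\otimes m)$, one has $(mn)m'=m(nm')$ and $(nm)n'=n(mn')$ for all $m,m'\in M$, $n,n'\in N$. Assume that at least one of $M,N$ is nonzero and that $M$ and $N$ are $2$-torsion free ($2x=0$ implies $x=0$). Let $\mathcal G=\begin{pmatrix}A&M\\N&B\end{pmatrix}$ be the associated generalized matrix algebra, with the usual matrix operations, let $\pi_A:\mathcal G\to A$ and $\pi_B:\mathcal G\to B$ be the projections onto the diagonal entries, and let $Z(\cdot)$ denote the center. The $(A,B)$-module $M$ is called strongly faithful if either (1) for $b\in B$, $Mb=0$ implies $b=0$, and for $a\in A$, $m\in M$, $am=0$ implies $a=0$ or $m=0$; or (2) for $a\in A$, $aM=0$ implies $a=0$, and for $m\in M$, $b\in B$, $mb=0$ implies $m=0$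 or $b=0$. Strong faithfulness of the $(B,A)$-module $N$ is defined in the same way, with the roles of $A$ and $B$ interchanged. With $[x,y]=xy-yx$, a Lie higher derivation (resp. higher derivation) on $\mathcal G$ is a sequence $(L_k)_{k\ge 0}$ of $R$-linear maps $\mathcal G\to\mathcal G$ with $L_0=\mathrm{id}$ and $L_k([x,y])=\sum_{i+j=k}[L_i(x),L_j(y)]$ (resp. $L_k(xy)=\sum_{i+j=k}L_i(x)L_j(y)$) for all $x,y\in\mathcal G$ and $k\ge 0$. A Lie higher derivation $(L_k)$ is called proper if there are a higher derivation $(D_k)_{k\ge 0}$ and $R$-linear maps $\tau_k:\mathcal G\to Z(\mathcal G)$, $k\ge 1$, with $\tau_k([x,y])=0$ for all $x,y\in\mathcal G$, such that $L_k=D_k+\tau_k$ for all $k\ge 1$. Theorem. Suppose that (i) $\pi_A(Z(\mathcal G))=Z(A)$ and $\pi_B(Z(\mathcal G))=Z(B)$, and (ii) $M$ or $N$ is strongly faithful. Then $\mathcal G$ has the Lie higher derivation (LHD) property: every Lie higher derivation on $\mathcal G$ is proper. -/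

import Mathlib

open MulOpposite

universe u v w x y

/-! ### Higher derivations and Lie higher derivations on a unital algebra -/

section HigherDerivations

variable {R : Type u} {G : Type v} [CommRing R] [Ring G] [Algebra R G]

/-- A higher derivation: a sequence of `R`-linear maps `D 0 = id, D 1, D 2, …` with
`D k (x y) = ∑_{i + j = k} D i x * D j y`. -/
structure IsHigherDerivation (D : ℕ → G →ₗ[R] G) : Prop where
  zero : D 0 = LinearMap.id
  map_mul : ∀ (k : ℕ) (x y : G),
    D k (x * y) = ∑ p ∈ Finset.HasAntidiagonal.antidiagonal k, D p.1 x * D p.2 y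

/-- A Lie higher derivation: a sequence of `R`-linear maps `L 0 = id, L 1, L 2, …` with
`L k [x, y] = ∑_{i + j = k} [L i x, L j y]`, where `[x, y] = x y - y x`. -/
structure IsLieHigherDerivation (L : ℕ → G →ₗ[R] G) : Prop where
  zero : L 0 = LinearMap.id
  map_commutator : ∀ (k : ℕ) (x y : G),
    L k (x * y - y * x) =
      ∑ p ∈ Finset.HasAntidiagonal.antidiagonal k, (L p.1 x * L p.2 y - L p.2 y * L p.1 x)

/-- A sequence `L` is proper if `L k = D k + τ k` for all `k ≥ 1`, where `D` is a higher
derivation and `τ 1, τ 2, …` are `R`-linear maps with values in the center that vanish at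
commutators. (The value `τ 0` plays no role.) -/
def IsProperLieHigherDerivation (L : ℕ → G →ₗ[R] G) : Prop :=
  IsLieHigherDerivation L ∧
  ∃ D τ : ℕ → G →ₗ[R] G, IsHigherDerivation D ∧
    (∀ k, 1 ≤ k → ∀ x : G, τ k x ∈ Set.center G) ∧
    (∀ k, 1 ≤ k → ∀ x y : G, τ k (x * y - y * x) = 0) ∧
    ∀ k, 1 ≤ k → L k = D k + τ k

variable (R G) in
/-- The Lie higher derivation property: every Lie higher derivation is proper. -/
def HasLHDProperty : Prop :=
  ∀ L : ℕ → G →ₗ[R] G, IsLieHigherDerivation L → IsProperLieHigherDerivation L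

end HigherDerivations

/-! ### Bimodules

An `(A, B)`-module `M` is a left `A`-module that is also a right `B`-module, i.e. a left module
over `Bᵐᵒᵖ`, with commuting actions; `m b` is written `op b • m`. -/

/-- Strong faithfulness of an `(A, B)`-module `M`. -/
def IsStronglyFaithful (A : Type v) (B : Type w) (M : Type x) [Ring A] [Ring B]
    [AddCommGroup M] [Module A M] [Module Bᵐᵒᵖ M] : Prop :=
  ((∀ b : B, (∀ m : M, op b • m = 0) → b = 0) ∧
    ∀ (a : A) (m : M), a • m = 0 → a = 0 ∨ m = 0) ∨
  ((∀ a : A, (∀ m : M, a • m = 0) → a = 0) ∧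
    ∀ (m : M) (b : B), op b • m = 0 → m = 0 ∨ b = 0)

/-! ### Morita contexts and generalized matrix algebras -/

/-- A Morita context `(A, B, M, N, Φ, Ψ)` over `R`. The bimodule homomorphisms
`M ⊗_B N → A` and `N ⊗_A M → B` are given as balanced bilinear maps, and the two commuting
diagrams are the associativity laws `(m n) m' = m (n m')` and `(n m) n' = n (m n')`. -/
structure MoritaContext (R : Type u) (A : Type v) (B : Type w) (M : Type x) (N : Type y)
    [CommRing R] [Ring A] [Algebra R A] [Ring B] [Algebra R B]
    [AddCommGroup M] [Module R M] [Module A M] [Module Bᵐᵒᵖ M]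
    [AddCommGroup N] [Module R N] [Module B N] [Module Aᵐᵒᵖ N] where
  /-- the pairing `M × N → A` -/
  Φ : M →ₗ[R] N →ₗ[R] A
  /-- the pairing `N × M → B` -/
  Ψ : N →ₗ[R] M →ₗ[R] B
  Φ_balanced : ∀ (m : M) (b : B) (n : N), Φ (op b • m) n = Φ m (b • n)
  Φ_left : ∀ (a : A) (m : M) (n : N), Φ (a • m) n = a * Φ m n
  Φ_right : ∀ (m : M) (n : N) (a : A), Φ m (op a • n) = Φ m n * a
  Ψ_balanced : ∀ (n : N) (a : A) (m : M), Ψ (op a • n) m = Ψ n (a • m)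
  Ψ_left : ∀ (b : B) (n : N) (m : M), Ψ (b • n) m = b * Ψ n m
  Ψ_right : ∀ (n : N) (m : M) (b : B), Ψ n (op b • m) = Ψ n m * b
  assoc_M : ∀ (m : M) (n : N) (m' : M), Φ m n • m' = op (Ψ n m') • m
  assoc_N : ∀ (n : N) (m : M) (n' : N), Ψ n m • n' = op (Φ m n') • n

section GeneralizedMatrixAlgebra

variable {R : Type u} {A : Type v} {B : Type w} {M : Type x} {N : Type y}
  [CommRing R] [Ring A] [Algebra R A] [Ring B] [Algebra R B]
  [AddCommGroup M] [Module R M] [Module A M] [Module Bᵐᵒᵖ M]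
  [AddCommGroup N] [Module R N] [Module B N] [Module Aᵐᵒᵖ N]

/-- The generalized matrix algebra of a Morita context: matrices `(a, m; n, b)`. -/
@[ext]
structure GenMatrixAlgebra (C : MoritaContext R A B M N) where
  /-- upper left entry -/
  a : A
  /-- upper right entry -/
  m : M
  /-- lower left entry -/
  n : N
  /-- lower right entry -/
  b : B

namespace GenMatrixAlgebra

variable {C : MoritaContext R A B M N}

instance : Zero (GenMatrixAlgebra C) := ⟨⟨0, 0, 0, 0⟩⟩
instance : One (GenMatrixAlgebra C) := ⟨⟨1, 0, 0, 1⟩⟩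
instance : Add (GenMatrixAlgebra C) := ⟨fun s t => ⟨s.a + t.a, s.m + t.m, s.n + t.n, s.b + t.b⟩⟩
instance : Neg (GenMatrixAlgebra C) := ⟨fun s => ⟨-s.a, -s.m, -s.n, -s.b⟩⟩
instance : SMul R (GenMatrixAlgebra C) := ⟨fun r s => ⟨r • s.a, r • s.m, r • s.n, r • s.b⟩⟩

/-- Matrix multiplication. -/
instance : Mul (GenMatrixAlgebra C) :=
  ⟨fun s t =>
    ⟨s.a * t.a + C.Φ s.m t.n, s.a • t.m + op t.b • s.m,
      op t.a • s.n + s.b • t.n, C.Ψ s.n t.m + s.b * t.b⟩⟩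

@[simp] theorem zero_a : (0 : GenMatrixAlgebra C).a = 0 := rfl
@[simp] theorem zero_m : (0 : GenMatrixAlgebra C).m = 0 := rfl
@[simp] theorem zero_n : (0 : GenMatrixAlgebra C).n = 0 := rfl
@[simp] theorem zero_b : (0 : GenMatrixAlgebra C).b = 0 := rfl
@[simp] theorem one_a : (1 : GenMatrixAlgebra C).a = 1 := rfl
@[simp] theorem one_m : (1 : GenMatrixAlgebra C).m = 0 := rfl
@[simp] theorem one_n : (1 : GenMatrixAlgebra C).n = 0 := rfl
@[simp] theorem one_b : (1 : GenMatrixAlgebra C).b = 1 := rfl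
@[simp] theorem add_a (s t : GenMatrixAlgebra C) : (s + t).a = s.a + t.a := rfl
@[simp] theorem add_m (s t : GenMatrixAlgebra C) : (s + t).m = s.m + t.m := rfl
@[simp] theorem add_n (s t : GenMatrixAlgebra C) : (s + t).n = s.n + t.n := rfl
@[simp] theorem add_b (s t : GenMatrixAlgebra C) : (s + t).b = s.b + t.b := rfl
@[simp] theorem neg_a (s : GenMatrixAlgebra C) : (-s).a = -s.a := rfl
@[simp] theorem neg_m (s : GenMatrixAlgebra C) : (-s).m = -s.m := rfl
@[simp] theorem neg_n (s : GenMatrixAlgebra C) : (-s).n = -s.n := rfl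
@[simp] theorem neg_b (s : GenMatrixAlgebra C) : (-s).b = -s.b := rfl
@[simp] theorem smul_a (r : R) (s : GenMatrixAlgebra C) : (r • s).a = r • s.a := rfl
@[simp] theorem smul_m (r : R) (s : GenMatrixAlgebra C) : (r • s).m = r • s.m := rfl
@[simp] theorem smul_n (r : R) (s : GenMatrixAlgebra C) : (r • s).n = r • s.n := rfl
@[simp] theorem smul_b (r : R) (s : GenMatrixAlgebra C) : (r • s).b = r • s.b := rfl
@[simp] theorem mul_a (s t : GenMatrixAlgebra C) :
    (s * t).a = s.a * t.a + C.Φ s.m t.n := rfl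
@[simp] theorem mul_m (s t : GenMatrixAlgebra C) :
    (s * t).m = s.a • t.m + op t.b • s.m := rfl
@[simp] theorem mul_n (s t : GenMatrixAlgebra C) :
    (s * t).n = op t.a • s.n + s.b • t.n := rfl
@[simp] theorem mul_b (s t : GenMatrixAlgebra C) :
    (s * t).b = C.Ψ s.n t.m + s.b * t.b := rfl

instance : AddCommGroup (GenMatrixAlgebra C) where
  add_assoc s t u := by ext <;> simp [add_assoc]
  zero_add s := by ext <;> simp
  add_zero s := by ext <;> simp
  add_comm s t := by ext <;> simp [add_comm]
  neg_add_cancel s := by ext <;> simp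
  nsmul := nsmulRec
  zsmul := zsmulRec

instance [SMulCommClass A Bᵐᵒᵖ M] [SMulCommClass B Aᵐᵒᵖ N] : Ring (GenMatrixAlgebra C) where
  __ := (inferInstance : AddCommGroup (GenMatrixAlgebra C))
  left_distrib s t u := by
    ext <;> simp [mul_add, add_smul, smul_add] <;> abel
  right_distrib s t u := by
    ext <;> simp [add_mul, add_smul, smul_add] <;> abel
  zero_mul s := by ext <;> simp
  mul_zero s := by ext <;> simp
  mul_assoc s t u := by
    ext
    · simp [C.Φ_left, C.Φ_right, C.Φ_balanced, add_mul, mul_add, mul_assoc]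
      abel
    · simp [C.assoc_M, add_smul, smul_add, mul_smul, smul_comm s.a (op u.b) t.m]
      abel
    · simp [C.assoc_N, add_smul, smul_add, mul_smul, smul_comm s.b (op _) _]
      abel
    · simp [C.Ψ_left, C.Ψ_right, C.Ψ_balanced, add_mul, mul_add, mul_assoc]
      abel
  one_mul s := by ext <;> simp
  mul_one s := by ext <;> simp

instance : Module R (GenMatrixAlgebra C) where
  one_smul s := by ext <;> simp
  mul_smul r r' s := by ext <;> simp [mul_smul]
  smul_zero r := by ext <;> simp
  smul_add r s t := by ext <;> simp
  add_smul r r' s := by ext <;> simp [add_smul]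
  zero_smul s := by ext <;> simp

instance [IsScalarTower R A M] [IsScalarTower R Bᵐᵒᵖ M] [SMulCommClass A Bᵐᵒᵖ M]
    [IsScalarTower R B N] [IsScalarTower R Aᵐᵒᵖ N] [SMulCommClass B Aᵐᵒᵖ N] :
    Algebra R (GenMatrixAlgebra C) :=
  Algebra.ofModule
    (fun r s t => by ext <;> simp [smul_add, smul_comm _ r])
    (fun r s t => by ext <;> simp [smul_add, smul_comm _ r])

/-- The projection `π_A` onto the upper left corner. -/
def projA (C : MoritaContext R A B M N) : GenMatrixAlgebra C →ₗ[R] A where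
  toFun s := s.a
  map_add' _ _ := rfl
  map_smul' _ _ := rfl

/-- The projection `π_B` onto the lower right corner. -/
def projB (C : MoritaContext R A B M N) : GenMatrixAlgebra C →ₗ[R] B where
  toFun s := s.b
  map_add' _ _ := rfl
  map_smul' _ _ := rfl

end GenMatrixAlgebra

end GeneralizedMatrixAlgebra

/-! Encode a Lie higher derivation as the single `R`-linear map `x ↦ ∑ L_k(x) t^k` from `G` to
`G[[t]]`. It is a Lie homomorphism reducing to the identity at `t = 0`; higher derivations
correspond in the same way to multiplicative maps. The theorem then says that such a Lie lift is a
multiplicative lift plus a central map.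

Let `p`, `q` be the diagonal idempotents. The series `L p` starts with `p`, so an inner automorphism
by a unit congruent to 1 makes it commute with `p` (`exists_conj_commute`). A normalized lift
preserves `p G q` and `q G p`, on which `ad p` acts as 1 and -1, distinct because there is no
2-torsion (`IsLieLift.offDiagonal`). An element of `p G p` is sent to a series commuting with `p`,
whose `q`-block has coefficients in the center of `q G q`. By (i) that block comes from a central
series, which can be subtracted (`IsLieLift.exists_central_part`); the same holds for `q G q`.

The corrected map `D` preserves all four corners, and faithfulness turns its Lie identity into
multiplicativity (`map_mul_of_corners`). Only the products `m n` and `n m` need strong faithfulness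
and the absence of 2-torsion. Most vanishing statements are proved on the lowest nonzero
coefficient, where a perturbed equation becomes its constant-term version. -/

/-! ### Power series over a noncommutative ring: lowest coefficients and fixed points. -/

section LeadingCoefficients

variable {G : Type v} [Ring G]

theorem coeff_add_mul_of_lower {a b : PowerSeries G} {k l : ℕ}
    (ha : ∀ i < k, PowerSeries.coeff i a = 0) (hb : ∀ j < l, PowerSeries.coeff j b = 0) :
    PowerSeries.coeff (k + l) (a * b) = PowerSeries.coeff k a * PowerSeries.coeff l b := by
  rw [PowerSeries.coeff_mul, Finset.sum_eq_single (k, l)]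
  · rintro ⟨i, j⟩ hij hne
    rw [Finset.HasAntidiagonal.mem_antidiagonal] at hij
    rcases lt_trichotomy i k with h | h | h
    · simp [ha i h]
    · exact absurd (Prod.ext h (by simp only at hij ⊢; omega)) hne
    · have : j < l := by simp only at hij; omega
      simp [hb j this]
  · intro h
    simp at h

theorem coeff_mul_of_lower_left {a : PowerSeries G} {k : ℕ}
    (ha : ∀ i < k, PowerSeries.coeff i a = 0) (b : PowerSeries G) :
    PowerSeries.coeff k (a * b) = PowerSeries.coeff k a * PowerSeries.coeff 0 b :=
  coeff_add_mul_of_lower (l := 0) ha (by simp)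

theorem coeff_mul_of_lower_right {b : PowerSeries G} {k : ℕ} (a : PowerSeries G)
    (hb : ∀ i < k, PowerSeries.coeff i b = 0) :
    PowerSeries.coeff k (a * b) = PowerSeries.coeff 0 a * PowerSeries.coeff k b := by
  simpa using coeff_add_mul_of_lower (a := a) (k := 0) (by simp) hb

theorem coeff_zero_mul_eq (a b : PowerSeries G) :
    PowerSeries.coeff 0 (a * b) = PowerSeries.coeff 0 a * PowerSeries.coeff 0 b :=
  coeff_mul_of_lower_left (by simp) b

/-- A power series vanishes if each coefficient vanishes as soon as all lower ones do. -/
theorem eq_zero_of_leading {a : PowerSeries G}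
    (h : ∀ k, (∀ i < k, PowerSeries.coeff i a = 0) → PowerSeries.coeff k a = 0) : a = 0 := by
  ext k
  induction k using Nat.strong_induction_on with
  | _ k ih => simpa using h k (by simpa using ih)

/-- A contracting self-map of the power series has a fixed point. -/
theorem exists_fixed_of_contracting (F : PowerSeries G → PowerSeries G)
    (hF : ∀ k x y, (∀ j < k, PowerSeries.coeff j x = PowerSeries.coeff j y) →
      PowerSeries.coeff k (F x) = PowerSeries.coeff k (F y)) : ∃ x, F x = x := by
  have step : ∀ n, ∀ k < n,
      PowerSeries.coeff k (F^[n] 0) = PowerSeries.coeff k (F^[n + 1] 0) := by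
    intro n
    induction n with
    | zero => simp
    | succ n ih =>
      intro k hk
      rw [Function.iterate_succ_apply' F n, Function.iterate_succ_apply' F (n + 1)]
      exact hF k _ _ fun j hj => ih j (by omega)
  -- Iterates `n` and `n + 1` agree strictly below degree `n`, so coefficient `k` is frozen only
  -- from iterate `k + 1` on.
  have stable : ∀ k m, PowerSeries.coeff k (F^[k + 1 + m] 0) =
      PowerSeries.coeff k (F^[k + 1] 0) := by
    intro k m
    induction m with
    | zero => rfl
    | succ m ih => rw [← ih, ← add_assoc]; exact (step _ k (by omega)).symm
  refine ⟨PowerSeries.mk fun k => PowerSeries.coeff k (F^[k + 1] 0), ?_⟩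
  ext k
  rw [PowerSeries.coeff_mk, Function.iterate_succ_apply']
  refine hF k _ _ fun j hj => ?_
  rw [PowerSeries.coeff_mk, ← stable j (k - (j + 1))]
  congr 3
  omega

theorem commute_of_coeff_center {z : PowerSeries G}
    (hz : ∀ k, PowerSeries.coeff k z ∈ Set.center G) (y : PowerSeries G) : z * y = y * z := by
  ext k
  rw [PowerSeries.coeff_mul, PowerSeries.coeff_mul, ← Finset.Nat.sum_antidiagonal_swap]
  exact Finset.sum_congr rfl fun i _ => ((Set.mem_center_iff.1 (hz i.2)).comm _).eq

theorem coeff_mem_center {z : PowerSeries G} (hz : ∀ y, z * y = y * z) (k : ℕ) :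
    PowerSeries.coeff k z ∈ Set.center G := by
  rw [Semigroup.mem_center_iff]
  intro g
  rw [← PowerSeries.coeff_C_mul, ← PowerSeries.coeff_mul_C, hz]

end LeadingCoefficients

/-! ### Peirce decomposition and conjugation of a perturbed idempotent. -/

section Peirce

variable {G : Type v} [Ring G]

/-- Complementary orthogonal idempotents. -/
structure IsPeircePair (p q : G) : Prop where
  add : p + q = 1
  mul : p * q = 0
  mul' : q * p = 0

namespace IsPeircePair

variable {p q : G}

theorem symm (h : IsPeircePair p q) : IsPeircePair q p :=
  ⟨by rw [add_comm, h.add], h.mul', h.mul⟩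

theorem idem (h : IsPeircePair p q) : p * p = p := by
  have := congrArg (p * ·) h.add
  simpa [mul_add, h.mul] using this

theorem map_C (h : IsPeircePair p q) :
    IsPeircePair (PowerSeries.C p) (PowerSeries.C q) :=
  ⟨by rw [← map_add, h.add, map_one], by rw [← map_mul, h.mul, map_zero],
    by rw [← map_mul, h.mul', map_zero]⟩

theorem decomp (h : IsPeircePair p q) (x : G) :
    x = p * x * p + p * x * q + q * x * p + q * x * q := by
  calc x = (p + q) * x * (p + q) := by rw [h.add]; simp
    _ = _ := by noncomm_ring

theorem decomp_of_commute (h : IsPeircePair p q) {x : G} (hx : x * p = p * x) :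
    x = p * x * p + q * x * q := by
  have h1 : p * x * q = 0 := by rw [← hx, mul_assoc, h.mul, mul_zero]
  have h2 : q * x * p = 0 := by rw [mul_assoc, hx, ← mul_assoc, h.mul', zero_mul]
  conv_lhs => rw [h.decomp x]
  rw [h1, h2, add_zero, add_zero]

theorem commute_symm (h : IsPeircePair p q) {x : G} (hx : x * p = p * x) : x * q = q * x := by
  rw [← add_right_inj (x * p), ← mul_add, h.add]
  conv_rhs => rw [hx, ← add_mul, h.add]
  simp

end IsPeircePair

/-- Membership in the Peirce corner `p G q`. -/
structure InCorner (p q x : G) : Prop where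
  left : p * x = x
  right : x * q = x

namespace InCorner

variable {p q r s x y : G}

theorem mul_mid (hp : p * p = p) (hq : q * q = q) (x : G) : InCorner p q (p * x * q) :=
  ⟨by rw [← mul_assoc, ← mul_assoc, hp], by rw [mul_assoc, hq]⟩

theorem mul_eq_zero (hx : InCorner p q x) (hy : InCorner r s y) (h : q * r = 0) :
    x * y = 0 := by
  rw [← hx.right, ← hy.left, mul_assoc, ← mul_assoc q, h, zero_mul, mul_zero]

theorem mul_eq_zero_left (hx : InCorner p q x) (h : r * p = 0) : r * x = 0 := by
  rw [← hx.left, ← mul_assoc, h, zero_mul]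

theorem mul_eq_zero_right (hx : InCorner p q x) (h : q * r = 0) : x * r = 0 := by
  rw [← hx.right, mul_assoc, h, mul_zero]

theorem mul (hx : InCorner p q x) (hy : InCorner r s y) : InCorner p s (x * y) :=
  ⟨by rw [← mul_assoc, hx.left], by rw [mul_assoc, hy.right]⟩

theorem sub (hx : InCorner p q x) (hy : InCorner p q y) : InCorner p q (x - y) :=
  ⟨by rw [mul_sub, hx.left, hy.left], by rw [sub_mul, hx.right, hy.right]⟩

theorem add (hx : InCorner p q x) (hy : InCorner p q y) : InCorner p q (x + y) :=
  ⟨by rw [mul_add, hx.left, hy.left], by rw [add_mul, hx.right, hy.right]⟩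

theorem eq_mid (hx : InCorner p q x) : p * x * q = x := by rw [hx.left, hx.right]

theorem coeff {x : PowerSeries G} (hx : InCorner (PowerSeries.C p) (PowerSeries.C q) x)
    (k : ℕ) : InCorner p q (PowerSeries.coeff k x) :=
  ⟨by rw [← PowerSeries.coeff_C_mul, hx.left], by rw [← PowerSeries.coeff_mul_C, hx.right]⟩

end InCorner

/-- Solution of a Riccati equation by successive approximation. -/
theorem exists_riccati {p q : G} (h : IsPeircePair p q) {f : PowerSeries G}
    (hf : PowerSeries.coeff 0 f = p) :
    ∃ x, InCorner (PowerSeries.C p) (PowerSeries.C q) x ∧ PowerSeries.coeff 0 x = 0 ∧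
      PowerSeries.C p * ((1 - x) * f * (1 + x)) * PowerSeries.C q = 0 := by
  set P := PowerSeries.C p with hP
  set Q := PowerSeries.C q with hQ
  have H : IsPeircePair P Q := h.map_C
  have hc : PowerSeries.coeff 0 (Q * f) = 0 := by
    rw [PowerSeries.coeff_C_mul, hf, h.mul']
  have hd : PowerSeries.coeff 0 (P * f - P) = 0 := by
    rw [map_sub, PowerSeries.coeff_C_mul, hf, h.idem, hP, PowerSeries.coeff_zero_C, sub_self]
  -- For `x` in the corner, the `P`-`Q` block of `(1 - x) f (1 + x)` is `PfQ + Pfx - xfQ - xfx`.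
  -- Writing `Pfx = x + (Pf - P)x` isolates `x`. The map contracts because `Qf` and `Pf - P` have
  -- zero constant term.
  obtain ⟨x, hx⟩ := exists_fixed_of_contracting
    (fun x => P * (x * (Q * f) + x * (Q * f) * x - f - (P * f - P) * x) * Q) (by
      intro k x y hxy
      have hl : ∀ j < k, PowerSeries.coeff j (x - y) = 0 := fun j hj => by
        rw [map_sub, hxy j hj, sub_self]
      simp only [hP, hQ, PowerSeries.coeff_C_mul, PowerSeries.coeff_mul_C]
      simp only [← hP, ← hQ]
      congr 2
      rw [← sub_eq_zero, ← map_sub]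
      have e : x * (Q * f) + x * (Q * f) * x - f - (P * f - P) * x -
          (y * (Q * f) + y * (Q * f) * y - f - (P * f - P) * y) =
          (x - y) * (Q * f) + (x - y) * ((Q * f) * x) + y * (Q * f) * (x - y) -
            (P * f - P) * (x - y) := by noncomm_ring
      rw [e, map_sub, map_add, map_add, coeff_mul_of_lower_left hl (Q * f),
        coeff_mul_of_lower_left hl (Q * f * x),
        coeff_mul_of_lower_right _ hl, coeff_mul_of_lower_right _ hl,
        hc, hd, (coeff_zero_mul_eq (Q * f) x).trans (by rw [hc, zero_mul]),
        (coeff_zero_mul_eq y (Q * f)).trans (by rw [hc, mul_zero])]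
      simp only [mul_zero, zero_mul, add_zero, sub_zero])
  have hcx : InCorner P Q x := by
    rw [← hx]; exact InCorner.mul_mid H.idem H.symm.idem _
  refine ⟨x, hcx, ?_, ?_⟩
  · rw [← hx]
    simp only [hP, hQ, PowerSeries.coeff_C_mul, PowerSeries.coeff_mul_C]
    simp only [← hP, ← hQ]
    simp only [map_add, map_sub _ _ f, map_sub _ _ ((P * f - P) * x),
      coeff_zero_mul_eq x, coeff_zero_mul_eq (P * f - P), coeff_zero_mul_eq (x * (Q * f)), hc, hd, hf]
    simp [mul_assoc, h.mul]
  · have e1 : P * x = x := hcx.left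
    have e2 : x * Q = x := hcx.right
    have e3 : P * (x * (Q * f) + x * (Q * f) * x - f - (P * f - P) * x) * Q =
        (P * x) * Q * f * Q + (P * x) * Q * f * (x * Q) - P * f * Q
          - P * P * f * (x * Q) + P * (P * (x * Q)) := by noncomm_ring
    rw [e3, e1, e2, H.idem, e1, e1] at hx
    have e4 : P * ((1 - x) * f * (1 + x)) * Q =
        P * f * Q + P * f * (x * Q) - (P * x) * f * Q - (P * x) * f * (x * Q) := by noncomm_ring
    rw [e4, e1, e2]
    have := sub_eq_zero.2 hx
    rw [← neg_eq_zero, ← this]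
    abel

/-- A power series whose constant coefficient is an idempotent `p` can be conjugated so that it
commutes with `p`. -/
theorem exists_conj_commute {p q : G} (h : IsPeircePair p q) {f : PowerSeries G}
    (hf : PowerSeries.coeff 0 f = p) :
    ∃ u v : PowerSeries G, u * v = 1 ∧ v * u = 1 ∧ PowerSeries.coeff 0 u = 1 ∧
      PowerSeries.coeff 0 v = 1 ∧
      (v * f * u) * PowerSeries.C p = PowerSeries.C p * (v * f * u) := by
  have H := h.map_C
  obtain ⟨x, hx, hx0, hxf⟩ := exists_riccati h hf
  have hxx : x * x = 0 := hx.mul_eq_zero hx H.mul'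
  set f₁ := (1 - x) * f * (1 + x) with hf₁
  have one0 : PowerSeries.coeff 0 (1 : PowerSeries G) = 1 := PowerSeries.coeff_zero_one
  have hf₁0 : PowerSeries.coeff 0 f₁ = p := by
    simp [hf₁, coeff_zero_mul_eq, map_add, map_sub, hx0, hf, one0]
  -- The other off-diagonal block is removed by the same equation with `p` and `q` exchanged; `1 -
  -- f₁` has constant term `q` and, up to sign, the same off-diagonal blocks as `f₁`.
  obtain ⟨y, hy, hy0, hyf⟩ := exists_riccati h.symm (f := 1 - f₁) (by
    rw [map_sub, hf₁0, one0, ← h.add, add_sub_cancel_left])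
  have hyy : y * y = 0 := hy.mul_eq_zero hy H.mul
  set P := PowerSeries.C p with hP
  set Q := PowerSeries.C q with hQ
  have inv : ∀ z : PowerSeries G, z * z = 0 → (1 + z) * (1 - z) = 1 ∧ (1 - z) * (1 + z) = 1 := by
    intro z hz
    constructor
    · have : (1 + z) * (1 - z) = 1 - z * z := by noncomm_ring
      rw [this, hz, sub_zero]
    · have : (1 - z) * (1 + z) = 1 - z * z := by noncomm_ring
      rw [this, hz, sub_zero]
  refine ⟨(1 + x) * (1 + y), (1 - y) * (1 - x), ?_, ?_, ?_, ?_, ?_⟩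
  · rw [mul_assoc, ← mul_assoc (1 + y), (inv y hyy).1, one_mul, (inv x hxx).1]
  · rw [mul_assoc, ← mul_assoc (1 - x), (inv x hxx).2, one_mul, (inv y hyy).2]
  · simp [coeff_zero_mul_eq, map_add, hx0, hy0, one0]
  · simp [coeff_zero_mul_eq, map_sub, hx0, hy0, one0]
  · have e : (1 - y) * (1 - x) * f * ((1 + x) * (1 + y)) = (1 - y) * f₁ * (1 + y) := by
      rw [hf₁]; simp only [mul_assoc]
    rw [e]
    set f₂ := (1 - y) * f₁ * (1 + y) with hf₂
    have h1 : Q * f₂ * P = 0 := by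
      have e1 : (1 - y) * (1 - f₁) * (1 + y) = 1 - f₂ := by
        rw [mul_sub, sub_mul, mul_one, (inv y hyy).2]
      rw [e1, mul_sub, sub_mul, mul_one, H.mul', zero_sub, neg_eq_zero] at hyf
      exact hyf
    -- The second conjugation leaves the `P`-`Q` block alone, since `P y = 0` and `y Q = 0`.
    have h2 : P * f₂ * Q = 0 := by
      have e1 : P * f₂ * Q = (P - P * y) * f₁ * (Q + y * Q) := by
        rw [hf₂]; noncomm_ring
      rw [e1, hy.mul_eq_zero_left H.mul, hy.mul_eq_zero_right H.mul, sub_zero, add_zero, hxf]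
    have e3 : f₂ * P = P * f₂ * P + Q * f₂ * P := by
      rw [← add_mul, ← add_mul, H.add, one_mul]
    have e4 : P * f₂ = P * f₂ * P + P * f₂ * Q := by
      rw [← mul_add, H.add, mul_one]
    rw [e4, h2, add_zero, e3, h1, add_zero]

end Peirce

/-! ### Lie lifts: corners and central parts after normalization. -/

section LieLifts

variable {R : Type u} {G : Type v} [CommRing R] [Ring G] [Algebra R G]

/-- A Lie higher derivation, written as a Lie homomorphism into the power series ring. -/
structure IsLieLift (L : G →ₗ[R] PowerSeries G) : Prop where
  coeff_zero : ∀ x, PowerSeries.coeff 0 (L x) = x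
  map_commutator : ∀ x y, L (x * y - y * x) = L x * L y - L y * L x

/-- Central elements of the corner `p G p` lift to central elements of `G`. -/
def CornerCenterLifts (p : G) : Prop :=
  ∀ a, InCorner p p a → (∀ a', InCorner p p a' → a * a' = a' * a) →
    ∃ z ∈ Set.center G, p * z * p = a

/-- The corner `p G p` contains no nonzero central element of `G`. -/
def CornerNoCenter (p : G) : Prop :=
  ∀ z ∈ Set.center G, InCorner p p z → z = 0

theorem CornerNoCenter.eq_zero {p : G} (h : CornerNoCenter p) {z : PowerSeries G}
    (hz : ∀ y, z * y = y * z) (hc : InCorner (PowerSeries.C p) (PowerSeries.C p) z) : z = 0 := by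
  ext k
  rw [h _ (coeff_mem_center hz k) (hc.coeff k), map_zero]

variable {p q : G} {L : G →ₗ[R] PowerSeries G}

/-- As `f` commutes with `P` and `Q`, each off-diagonal block of `y` commutes with `f` too. Its
lowest nonzero coefficient would commute with `p`, which is impossible in `p G q` or `q G p`. -/
theorem commute_of_commute_perturbed (hp : IsPeircePair p q) {f y : PowerSeries G}
    (hf0 : PowerSeries.coeff 0 f = p) (hf : f * PowerSeries.C p = PowerSeries.C p * f)
    (hy : f * y = y * f) : y * PowerSeries.C p = PowerSeries.C p * y := by
  set P := PowerSeries.C p with hP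
  set Q := PowerSeries.C q with hQ
  have H : IsPeircePair P Q := hp.map_C
  have hfQ := H.commute_symm hf
  have key1 : P * y * Q = 0 := by
    have hw : InCorner P Q (P * y * Q) := InCorner.mul_mid H.idem H.symm.idem y
    have hc : f * (P * y * Q) = (P * y * Q) * f := by
      rw [mul_assoc _ Q, ← hfQ, ← mul_assoc, ← mul_assoc, hf, mul_assoc P f, hy]
      simp only [mul_assoc]
    refine eq_zero_of_leading fun k hk => ?_
    have e := congrArg (PowerSeries.coeff k) hc
    rw [coeff_mul_of_lower_right _ hk, coeff_mul_of_lower_left hk, hf0, (hw.coeff k).left,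
      (hw.coeff k).mul_eq_zero_right hp.mul'] at e
    exact e
  have key2 : Q * y * P = 0 := by
    have hw : InCorner Q P (Q * y * P) := InCorner.mul_mid H.symm.idem H.idem y
    have hc : f * (Q * y * P) = (Q * y * P) * f := by
      rw [mul_assoc _ P, ← hf, ← mul_assoc, ← mul_assoc, hfQ, mul_assoc Q f, hy]
      simp only [mul_assoc]
    refine eq_zero_of_leading fun k hk => ?_
    have e := congrArg (PowerSeries.coeff k) hc
    rw [coeff_mul_of_lower_right _ hk, coeff_mul_of_lower_left hk, hf0, (hw.coeff k).right,
      (hw.coeff k).mul_eq_zero_left hp.mul] at e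
    exact e.symm
  have e3 : y * P = P * y * P + Q * y * P := by rw [← add_mul, ← add_mul, H.add, one_mul]
  have e4 : P * y = P * y * P + P * y * Q := by rw [← mul_add, H.add, mul_one]
  rw [e4, key1, add_zero, e3, key2, add_zero]

theorem IsLieLift.commute_image (hL : IsLieLift L) {x y : G} (h : x * y = y * x) :
    L x * L y = L y * L x := by
  rw [← sub_eq_zero, ← hL.map_commutator, h, sub_self, map_zero]

theorem IsLieLift.diagonal (hp : IsPeircePair p q) (hL : IsLieLift L)
    (hc : L p * PowerSeries.C p = PowerSeries.C p * L p) {x : G} (hx : p * x = x * p) :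
    L x * PowerSeries.C p = PowerSeries.C p * L x :=
  commute_of_commute_perturbed hp (hL.coeff_zero p) hc (hL.commute_image hx)

theorem IsLieLift.normalized_symm (hp : IsPeircePair p q) (hL : IsLieLift L)
    (hc : L p * PowerSeries.C p = PowerSeries.C p * L p) :
    L q * PowerSeries.C q = PowerSeries.C q * L q :=
  hp.map_C.commute_symm (hL.diagonal hp hc (hp.mul.trans hp.mul'.symm))

/-- The off-diagonal corners are preserved. -/
theorem IsLieLift.offDiagonal (hp : IsPeircePair p q) (hL : IsLieLift L)
    (hc : L p * PowerSeries.C p = PowerSeries.C p * L p)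
    (h2 : ∀ n, InCorner q p n → n + n = 0 → n = 0) {x : G} (hx : InCorner p q x) :
    InCorner (PowerSeries.C p) (PowerSeries.C q) (L x) := by
  have hf0 := hL.coeff_zero p
  have hy : L p * L x - L x * L p = L x := by
    rw [← hL.map_commutator, hx.left, hx.mul_eq_zero_right hp.mul', sub_zero]
  generalize L x = y at hy
  generalize L p = f at hy hc hf0
  set P := PowerSeries.C p with hP
  set Q := PowerSeries.C q with hQ
  have H : IsPeircePair P Q := hp.map_C
  have hfQ := H.commute_symm hc
  -- The equation `[f, y] = y` passes to each Peirce block of `y`; on a lowest coefficient it reads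
  -- `[p, w] = w`.
  have comp : ∀ {r s : PowerSeries G}, f * r = r * f → f * s = s * f →
      f * (r * y * s) - (r * y * s) * f = r * y * s := by
    intro r s hr hs
    conv_rhs => rw [← hy]
    rw [mul_assoc (r * y), ← hs, ← mul_assoc f, ← mul_assoc f, hr]
    noncomm_ring
  have lead : ∀ {w : PowerSeries G}, f * w - w * f = w →
      ∀ k, (∀ i < k, PowerSeries.coeff i w = 0) →
        p * PowerSeries.coeff k w - PowerSeries.coeff k w * p = PowerSeries.coeff k w := by
    intro w hw k hk
    have e := congrArg (PowerSeries.coeff k) hw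
    rwa [map_sub, coeff_mul_of_lower_right _ hk, coeff_mul_of_lower_left hk, hf0] at e
  have k1 : P * y * P = 0 := by
    have hw : InCorner P P (P * y * P) := InCorner.mul_mid H.idem H.idem y
    refine eq_zero_of_leading fun k hk => ?_
    have e := lead (comp hc hc) k hk
    rw [(hw.coeff k).left, (hw.coeff k).right, sub_self] at e
    exact e.symm
  have k2 : Q * y * Q = 0 := by
    have hw : InCorner Q Q (Q * y * Q) := InCorner.mul_mid H.symm.idem H.symm.idem y
    refine eq_zero_of_leading fun k hk => ?_
    have e := lead (comp hfQ hfQ) k hk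
    rw [(hw.coeff k).mul_eq_zero_left hp.mul, (hw.coeff k).mul_eq_zero_right hp.mul',
      sub_self] at e
    exact e.symm
  -- Here `ad p` is -1, so the lowest coefficient satisfies `-w = w`: 2-torsion in the opposite
  -- corner `q G p` has to be excluded.
  have k3 : Q * y * P = 0 := by
    have hw : InCorner Q P (Q * y * P) := InCorner.mul_mid H.symm.idem H.idem y
    refine eq_zero_of_leading fun k hk => ?_
    have e := lead (comp hfQ hc) k hk
    rw [(hw.coeff k).mul_eq_zero_left hp.mul, (hw.coeff k).right, zero_sub] at e
    refine h2 _ (hw.coeff k) ?_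
    nth_rw 1 [← e]
    exact neg_add_cancel _
  have e := H.decomp y
  rw [k1, k2, k3, zero_add, add_zero, add_zero] at e
  rw [e]
  exact InCorner.mul_mid H.idem H.symm.idem y

/-- If a power series commutes with a perturbation, with coefficients in `S`, of every element of
`S`, then its coefficients commute with `S`. -/
theorem coeff_commute_of_commute_perturbed {h : PowerSeries G} {S : Set G}
    (hS : ∀ b ∈ S, ∃ w : PowerSeries G, PowerSeries.coeff 0 w = b ∧
      (∀ k, PowerSeries.coeff k w ∈ S) ∧ h * w = w * h) (k : ℕ) :
    ∀ b ∈ S, PowerSeries.coeff k h * b = b * PowerSeries.coeff k h := by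
  induction k using Nat.strong_induction_on with
  | _ k ih =>
    intro b hb
    obtain ⟨w, hw0, hwS, hw⟩ := hS b hb
    have e := congrArg (PowerSeries.coeff k) hw
    -- Coefficient `k` of `h w - w h` is the sum of the commutators `[h_i, w_{k-i}]`. Those with `i
    -- < k` vanish by induction, because `w_{k-i}` lies in `S`, and `[h_k, b]` remains.
    rw [← sub_eq_zero, PowerSeries.coeff_mul, PowerSeries.coeff_mul,
      ← Finset.Nat.sum_antidiagonal_swap (f := fun i =>
        PowerSeries.coeff i.1 w * PowerSeries.coeff i.2 h),
      ← Finset.sum_sub_distrib, Finset.sum_eq_single (k, 0)] at e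
    · simpa [hw0, sub_eq_zero] using e
    · rintro ⟨i, j⟩ hij hne
      rw [Finset.HasAntidiagonal.mem_antidiagonal] at hij
      have hi : i < k := by
        rcases Nat.lt_or_ge i k with h | h
        · exact h
        · exact absurd (Prod.ext (by simp only at hij ⊢; omega) (by simp only at hij ⊢; omega)) hne
      exact sub_eq_zero.2 (ih i hi _ (hwS j))
    · simp

/-- The central part of a normalized Lie lift on the corner `p G p`. -/
theorem IsLieLift.exists_central_part (hp : IsPeircePair p q) (hL : IsLieLift L)
    (hc : L p * PowerSeries.C p = PowerSeries.C p * L p)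
    (hq : CornerCenterLifts q) (hU : CornerNoCenter p) :
    ∃ T : G →ₗ[R] PowerSeries G, (∀ x y, T x * y = y * T x) ∧
      (∀ x, InCorner (PowerSeries.C p) (PowerSeries.C p) (L (p * x * p) - T x)) ∧
      (∀ x, p * x * p = 0 → T x = 0) ∧ ∀ x, PowerSeries.coeff 0 (T x) = 0 := by
  set P := PowerSeries.C p with hP
  set Q := PowerSeries.C q with hQ
  have H : IsPeircePair P Q := hp.map_C
  have ex : ∀ x, ∃ z : PowerSeries G, (∀ y, z * y = y * z) ∧
      InCorner P P (L (p * x * p) - z) := by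
    intro x
    have hx : InCorner p p (p * x * p) := InCorner.mul_mid hp.idem hp.idem x
    generalize p * x * p = a at hx
    have hd := hL.diagonal hp hc (hx.left.trans hx.right.symm)
    have hdQ := H.commute_symm hd
    -- For `b` in `q G q`, `a b = b a = 0`, so `L a` and `L b` commute, and so do their `Q`-blocks.
    -- The `Q`-block of `L b` perturbs `b` inside `q G q`.
    have hcen : ∀ k, ∃ z ∈ Set.center G, q * z * q = PowerSeries.coeff k (Q * L a * Q) := by
      intro k
      have hcor := (InCorner.mul_mid H.symm.idem H.symm.idem (L a)).coeff k
      refine hq _ hcor fun b hb => ?_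
      refine coeff_commute_of_commute_perturbed (S := {b | InCorner q q b}) ?_ k b hb
      intro b hb
      have hab : a * b = b * a := by
        rw [hx.mul_eq_zero hb hp.mul, hb.mul_eq_zero hx hp.mul']
      have hbd := hL.diagonal hp hc ((hb.mul_eq_zero_left hp.mul).trans
        (hb.mul_eq_zero_right hp.mul').symm)
      have hbQ := H.commute_symm hbd
      have hLab := hL.commute_image hab
      refine ⟨Q * L b * Q, ?_, fun k =>
        (InCorner.mul_mid H.symm.idem H.symm.idem (L b)).coeff k, ?_⟩
      · rw [hQ, PowerSeries.coeff_mul_C, PowerSeries.coeff_C_mul, hL.coeff_zero, hb.eq_mid]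
      · have e : ∀ s t : PowerSeries G, s * Q = Q * s → t * Q = Q * t →
            (Q * s * Q) * (Q * t * Q) = Q * (s * t) * Q := by
          intro s t hs ht
          rw [mul_assoc (Q * s), ← mul_assoc Q (Q * t), ← mul_assoc Q Q, H.symm.idem, mul_assoc Q s,
            ← mul_assoc s (Q * t), ← mul_assoc s Q, hs, ← mul_assoc Q, ← mul_assoc Q,
            ← mul_assoc Q, H.symm.idem, ← mul_assoc Q s]
        rw [e _ _ hdQ hbQ, e _ _ hbQ hdQ, hLab]
    choose z hz hzq using hcen
    have hzc := commute_of_coeff_center (z := PowerSeries.mk z) (by simpa using hz)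
    refine ⟨PowerSeries.mk z, hzc, ?_⟩
    have hQz : Q * (L a - PowerSeries.mk z) * Q = 0 := by
      rw [mul_sub, sub_mul, sub_eq_zero]
      ext k
      rw [← hzq, hQ, PowerSeries.coeff_mul_C, PowerSeries.coeff_C_mul, PowerSeries.coeff_mk]
    have hdz : (L a - PowerSeries.mk z) * P = P * (L a - PowerSeries.mk z) := by
      rw [sub_mul, mul_sub, hd, hzc]
    rw [H.decomp_of_commute hdz, hQz, add_zero]
    exact InCorner.mul_mid H.idem H.idem _
  choose T hT hTc using ex
  -- Two admissible corrections differ by a central series in the `P`-corner, hence by 0. This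
  -- uniqueness makes the chosen `T` linear.
  have uniq : ∀ {z : PowerSeries G} (x : G), (∀ y, z * y = y * z) →
      InCorner P P (L (p * x * p) - z) → T x = z := by
    intro z x hz hzc
    rw [← sub_eq_zero]
    refine hU.eq_zero (fun y => by rw [sub_mul, mul_sub, hT, hz]) ?_
    have := hzc.sub (hTc x)
    rwa [sub_sub_sub_cancel_left] at this
  refine ⟨{ toFun := T, map_add' := fun x y => ?_, map_smul' := fun r x => ?_ }, hT, hTc, ?_, ?_⟩
  · refine uniq _ (fun y => by simp only [add_mul, mul_add, hT]) ?_
    have := (hTc x).add (hTc y)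
    rwa [sub_add_sub_comm, ← map_add, ← add_mul, ← mul_add] at this
  · refine uniq _ (fun y => ?_) ?_
    · simp only [RingHom.id_apply, smul_mul_assoc, mul_smul_comm, hT]
    · have h := hTc x
      have e : L (p * (r • x) * p) - (RingHom.id R) r • T x = r • (L (p * x * p) - T x) := by
        rw [mul_smul_comm, smul_mul_assoc, map_smul, smul_sub, RingHom.id_apply]
      rw [e]
      exact ⟨by rw [mul_smul_comm, h.left], by rw [smul_mul_assoc, h.right]⟩
  · intro x hx
    refine uniq x (by simp) ?_
    rw [hx, map_zero, sub_zero]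
    exact ⟨mul_zero _, zero_mul _⟩
  · intro x
    have h := (hTc x).coeff 0
    rw [map_sub, hL.coeff_zero] at h
    -- The constant term of `L (p * x * p) - T x` is `p * x * p` minus that of `T x`, so the latter
    -- lies in `p G p` as well.
    refine hU _ (coeff_mem_center (hT x) 0) ?_
    have := (InCorner.mul_mid hp.idem hp.idem x).sub h
    rwa [sub_sub_cancel] at this

end LieLifts

/-! ### From Lie homomorphism to multiplicativity. -/

section Multiplicativity

variable {R : Type u} {G : Type v} [CommRing R] [Ring G] [Algebra R G]

/-- Strong faithfulness of the corner `p G q` as a bimodule over `p G p` and `q G q`. -/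
def CornerStronglyFaithful (p q : G) : Prop :=
  ((∀ b, InCorner q q b → (∀ m, InCorner p q m → m * b = 0) → b = 0) ∧
    ∀ a m, InCorner p p a → InCorner p q m → a * m = 0 → a = 0 ∨ m = 0) ∨
  ((∀ a, InCorner p p a → (∀ m, InCorner p q m → a * m = 0) → a = 0) ∧
    ∀ m b, InCorner p q m → InCorner q q b → m * b = 0 → m = 0 ∨ b = 0)

section Faithful

variable {p q : G}

theorem CornerStronglyFaithful.left (h : CornerStronglyFaithful p q)
    (hne : ∃ m, InCorner p q m ∧ m ≠ 0) {a : G} (ha : InCorner p p a)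
    (h0 : ∀ m, InCorner p q m → a * m = 0) : a = 0 := by
  obtain ⟨m, hm, hm0⟩ := hne
  rcases h with h | h
  · exact (h.2 a m ha hm (h0 m hm)).resolve_right hm0
  · exact h.1 a ha h0

theorem CornerStronglyFaithful.right (h : CornerStronglyFaithful p q)
    (hne : ∃ m, InCorner p q m ∧ m ≠ 0) {b : G} (hb : InCorner q q b)
    (h0 : ∀ m, InCorner p q m → m * b = 0) : b = 0 := by
  obtain ⟨m, hm, hm0⟩ := hne
  rcases h with h | h
  · exact h.1 b hb h0
  · exact (h.2 m b hm hb (h0 m hm)).resolve_left hm0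

/-- A central `z` in `p G p` satisfies `z m = m z = 0` for all `m` in `p G q`. -/
theorem CornerStronglyFaithful.noCenter_left (h : CornerStronglyFaithful p q)
    (hp : IsPeircePair p q) (hne : ∃ m, InCorner p q m ∧ m ≠ 0) : CornerNoCenter p := by
  intro z hz hc
  refine h.left hne hc fun m hm => ?_
  rw [((Set.mem_center_iff.1 hz).comm m).eq, hm.mul_eq_zero hc hp.mul']

theorem CornerStronglyFaithful.noCenter_right (h : CornerStronglyFaithful p q)
    (hp : IsPeircePair p q) (hne : ∃ m, InCorner p q m ∧ m ≠ 0) : CornerNoCenter q := by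
  intro z hz hc
  refine h.right hne hc fun m hm => ?_
  rw [← ((Set.mem_center_iff.1 hz).comm m).eq, hc.mul_eq_zero hm hp.mul']

end Faithful

/-- A Lie lift without central part that preserves the Peirce corners is multiplicative. -/
theorem map_mul_of_corners {p q : G} (hp : IsPeircePair p q) {D T : G →ₗ[R] PowerSeries G}
    (hD0 : ∀ x, PowerSeries.coeff 0 (D x) = x)
    (hpp : ∀ x, InCorner p p x → InCorner (PowerSeries.C p) (PowerSeries.C p) (D x))
    (hpq : ∀ x, InCorner p q x → InCorner (PowerSeries.C p) (PowerSeries.C q) (D x))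
    (hqp : ∀ x, InCorner q p x → InCorner (PowerSeries.C q) (PowerSeries.C p) (D x))
    (hqq : ∀ x, InCorner q q x → InCorner (PowerSeries.C q) (PowerSeries.C q) (D x))
    (hT : ∀ x y, T x * y = y * T x)
    (hTpq : ∀ x, InCorner p q x → T x = 0) (hTqp : ∀ x, InCorner q p x → T x = 0)
    (hlie : ∀ x y, D (x * y - y * x) + T (x * y - y * x) = D x * D y - D y * D x)
    (h2 : ∀ m, InCorner p q m → m + m = 0 → m = 0)
    (hsf : CornerStronglyFaithful p q) (hne : ∃ m, InCorner p q m ∧ m ≠ 0) (x y : G) :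
    D (x * y) = D x * D y := by
  set P := PowerSeries.C p with hP
  set Q := PowerSeries.C q with hQ
  have H : IsPeircePair P Q := hp.map_C
  -- When one of the two orders vanishes before and after applying `D`, the Lie identity is already
  -- the product rule.
  have off : ∀ x y, y * x = 0 → D y * D x = 0 → T (x * y) = 0 → D (x * y) = D x * D y := by
    intro x y h1 h2 h3
    have := hlie x y
    rwa [h1, h2, sub_zero, sub_zero, h3, add_zero] at this
  have am : ∀ a m, InCorner p p a → InCorner p q m → D (a * m) = D a * D m := fun a m ha hm =>
    off a m (hm.mul_eq_zero ha hp.mul') ((hpq m hm).mul_eq_zero (hpp a ha) H.mul')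
      (hTpq _ (ha.mul hm))
  have mb : ∀ m b, InCorner p q m → InCorner q q b → D (m * b) = D m * D b := fun m b hm hb =>
    off m b (hb.mul_eq_zero hm hp.mul') ((hqq b hb).mul_eq_zero (hpq m hm) H.mul')
      (hTpq _ (hm.mul hb))
  have bn : ∀ b n, InCorner q q b → InCorner q p n → D (b * n) = D b * D n := fun b n hb hn =>
    off b n (hn.mul_eq_zero hb hp.mul) ((hqp n hn).mul_eq_zero (hqq b hb) H.mul)
      (hTqp _ (hb.mul hn))
  have na : ∀ n a, InCorner q p n → InCorner p p a → D (n * a) = D n * D a := fun n a hn ha =>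
    off n a (ha.mul_eq_zero hn hp.mul) ((hpp a ha).mul_eq_zero (hqp n hn) H.mul)
      (hTqp _ (hn.mul ha))
  -- Since `D m` starts with `m`, the lowest coefficient of `c` annihilates `p G q`.
  have fl : ∀ c, InCorner P P c → (∀ m, InCorner p q m → c * D m = 0) → c = 0 := by
    intro c hc h0
    refine eq_zero_of_leading fun k hk => hsf.left hne (hc.coeff k) fun m hm => ?_
    have := congrArg (PowerSeries.coeff k) (h0 m hm)
    rwa [coeff_mul_of_lower_left hk, hD0, map_zero] at this
  have fr : ∀ c, InCorner Q Q c → (∀ m, InCorner p q m → D m * c = 0) → c = 0 := by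
    intro c hc h0
    refine eq_zero_of_leading fun k hk => hsf.right hne (hc.coeff k) fun m hm => ?_
    have := congrArg (PowerSeries.coeff k) (h0 m hm)
    rwa [coeff_mul_of_lower_right _ hk, hD0, map_zero] at this
  have aa : ∀ a a', InCorner p p a → InCorner p p a' → D (a * a') = D a * D a' := by
    intro a a' ha ha'
    rw [← sub_eq_zero]
    refine fl _ ((hpp _ (ha.mul ha')).sub ((hpp a ha).mul (hpp a' ha'))) fun m hm => ?_
    rw [sub_mul, ← am _ m (ha.mul ha') hm, mul_assoc (D a), ← am a' m ha' hm,
      ← am a _ ha (ha'.mul hm), mul_assoc, sub_self]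
  have bb : ∀ b b', InCorner q q b → InCorner q q b' → D (b * b') = D b * D b' := by
    intro b b' hb hb'
    rw [← sub_eq_zero]
    refine fr _ ((hqq _ (hb.mul hb')).sub ((hqq b hb).mul (hqq b' hb'))) fun m hm => ?_
    rw [mul_sub, ← mb m _ hm (hb.mul hb'), ← mul_assoc (D m), ← mb m b hm hb,
      ← mb _ b' (hm.mul hb) hb', mul_assoc, sub_self]
  have cA : ∀ m n, InCorner p q m → InCorner q p n → InCorner P P (D (m * n) - D m * D n) :=
    fun m n hm hn => (hpp _ (hm.mul hn)).sub ((hpq m hm).mul (hqp n hn))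
  have cB : ∀ m n, InCorner p q m → InCorner q p n → InCorner Q Q (D (n * m) - D n * D m) :=
    fun m n hm hn => (hqq _ (hn.mul hm)).sub ((hqp n hn).mul (hpq m hm))
  -- Let `α = D(mn) - D(m)D(n)` and `β = D(nm) - D(n)D(m)`. The Lie identity says that `α - β` is
  -- central, and commuting it past `D m'` leaves only the terms `α D(m')` and `-D(m') β`.
  have cen : ∀ m n, InCorner p q m → InCorner q p n → ∀ m', InCorner p q m' →
      (D (m * n) - D m * D n) * D m' = -(D m' * (D (n * m) - D n * D m)) := by
    intro m n hm hn m' hm'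
    have e1 : (D (m * n) - D m * D n) - (D (n * m) - D n * D m) = -T (m * n - n * m) := by
      have := hlie m n
      rw [map_sub D] at this
      rw [eq_neg_iff_add_eq_zero, ← sub_eq_zero.2 this]
      abel
    have e2 : ((D (m * n) - D m * D n) - (D (n * m) - D n * D m)) * D m' =
        D m' * ((D (m * n) - D m * D n) - (D (n * m) - D n * D m)) := by
      rw [e1, neg_mul, mul_neg, hT]
    rwa [sub_mul _ _ (D m'), mul_sub (D m'), (cB m n hm hn).mul_eq_zero (hpq m' hm') H.mul',
      (hpq m' hm').mul_eq_zero (cA m n hm hn) H.mul', sub_zero, zero_sub] at e2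
  -- Both sides compare `D(mnm)` with `D(m)D(n)D(m)`. Against `cen` at `m' = m` the sign is
  -- opposite, so `2 α D(m) = 0`.
  have asc : ∀ m n, InCorner p q m → InCorner q p n →
      (D (m * n) - D m * D n) * D m = D m * (D (n * m) - D n * D m) := by
    intro m n hm hn
    rw [sub_mul, mul_sub, ← am _ m (hm.mul hn) hm, ← mb m _ hm (hn.mul hm), mul_assoc, mul_assoc]
  have zero : ∀ m n, InCorner p q m → InCorner q p n →
      (D (m * n) - D m * D n) * D m = 0 := by
    intro m n hm hn
    have e : (D (m * n) - D m * D n) * D m + (D (m * n) - D m * D n) * D m = 0 := by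
      nth_rw 1 [cen m n hm hn m hm]
      rw [asc m n hm hn, neg_add_cancel]
    ext k
    refine h2 _ (((cA m n hm hn).mul (hpq m hm)).coeff k) ?_
    rw [← map_add, e, map_zero]
  have strong : ∀ m n, InCorner p q m → InCorner q p n →
      D (m * n) - D m * D n = 0 ∨ D (n * m) - D n * D m = 0 := by
    intro m n hm hn
    -- The alternatives in strong faithfulness carry information only for `m ≠ 0`.
    by_cases hm0 : m = 0
    · left
      rw [hm0, zero_mul, map_zero, zero_mul, sub_zero]
    rcases hsf with h | h
    · left
      refine eq_zero_of_leading fun k hk => ?_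
      have := congrArg (PowerSeries.coeff k) (zero m n hm hn)
      rw [coeff_mul_of_lower_left hk, hD0, map_zero] at this
      exact (h.2 _ _ ((cA m n hm hn).coeff k) hm this).resolve_right hm0
    · right
      refine eq_zero_of_leading fun k hk => ?_
      have := congrArg (PowerSeries.coeff k) ((asc m n hm hn).symm.trans (zero m n hm hn))
      rw [coeff_mul_of_lower_right _ hk, hD0, map_zero] at this
      exact (h.2 _ _ hm ((cB m n hm hn).coeff k) this).resolve_left hm0
  -- If `β = 0`, then `cen` gives `α D(m') = 0` for every `m'`, so `α = 0` by faithfulness.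
  have mn : ∀ m n, InCorner p q m → InCorner q p n → D (m * n) = D m * D n := by
    intro m n hm hn
    rcases strong m n hm hn with h | h
    · exact sub_eq_zero.1 h
    · refine sub_eq_zero.1 (fl _ (cA m n hm hn) fun m' hm' => ?_)
      rw [cen m n hm hn m' hm', h, mul_zero, neg_zero]
  have nm : ∀ n m, InCorner q p n → InCorner p q m → D (n * m) = D n * D m := by
    intro n m hn hm
    refine sub_eq_zero.1 (fr _ (cB m n hm hn) fun m' hm' => ?_)
    rw [← neg_eq_zero, ← cen m n hm hn m' hm', mn m n hm hn, sub_self, zero_mul]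
  have triv : ∀ x y, x * y = 0 → D x * D y = 0 → D (x * y) = D x * D y := by
    intro x y h1 h2
    rw [h1, h2, map_zero]
  have ext_right : ∀ x, (∀ y, InCorner p p y → D (x * y) = D x * D y) →
      (∀ y, InCorner p q y → D (x * y) = D x * D y) →
      (∀ y, InCorner q p y → D (x * y) = D x * D y) →
      (∀ y, InCorner q q y → D (x * y) = D x * D y) → ∀ y, D (x * y) = D x * D y := by
    intro x h1 h2 h3 h4 y
    rw [hp.decomp y]
    simp only [mul_add, map_add]
    rw [h1 _ (InCorner.mul_mid hp.idem hp.idem y), h2 _ (InCorner.mul_mid hp.idem hp.symm.idem y),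
      h3 _ (InCorner.mul_mid hp.symm.idem hp.idem y),
      h4 _ (InCorner.mul_mid hp.symm.idem hp.symm.idem y)]
  have h1 : ∀ x, InCorner p p x → ∀ y, D (x * y) = D x * D y := fun x hx =>
    ext_right x (fun y hy => aa x y hx hy) (fun y hy => am x y hx hy)
      (fun y hy => triv x y (hx.mul_eq_zero hy hp.mul)
        ((hpp x hx).mul_eq_zero (hqp y hy) H.mul))
      (fun y hy => triv x y (hx.mul_eq_zero hy hp.mul)
        ((hpp x hx).mul_eq_zero (hqq y hy) H.mul))
  have h2 : ∀ x, InCorner p q x → ∀ y, D (x * y) = D x * D y := fun x hx =>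
    ext_right x
      (fun y hy => triv x y (hx.mul_eq_zero hy hp.mul')
        ((hpq x hx).mul_eq_zero (hpp y hy) H.mul'))
      (fun y hy => triv x y (hx.mul_eq_zero hy hp.mul')
        ((hpq x hx).mul_eq_zero (hpq y hy) H.mul'))
      (fun y hy => mn x y hx hy) (fun y hy => mb x y hx hy)
  have h3 : ∀ x, InCorner q p x → ∀ y, D (x * y) = D x * D y := fun x hx =>
    ext_right x (fun y hy => na x y hx hy) (fun y hy => nm x y hx hy)
      (fun y hy => triv x y (hx.mul_eq_zero hy hp.mul)
        ((hqp x hx).mul_eq_zero (hqp y hy) H.mul))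
      (fun y hy => triv x y (hx.mul_eq_zero hy hp.mul)
        ((hqp x hx).mul_eq_zero (hqq y hy) H.mul))
  have h4 : ∀ x, InCorner q q x → ∀ y, D (x * y) = D x * D y := fun x hx =>
    ext_right x
      (fun y hy => triv x y (hx.mul_eq_zero hy hp.mul')
        ((hqq x hx).mul_eq_zero (hpp y hy) H.mul'))
      (fun y hy => triv x y (hx.mul_eq_zero hy hp.mul')
        ((hqq x hx).mul_eq_zero (hpq y hy) H.mul'))
      (fun y hy => bn x y hx hy) (fun y hy => bb x y hx hy)
  rw [hp.decomp x]
  simp only [add_mul _ _ y, map_add]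
  rw [h1 _ (InCorner.mul_mid hp.idem hp.idem x), h2 _ (InCorner.mul_mid hp.idem hp.symm.idem x),
    h3 _ (InCorner.mul_mid hp.symm.idem hp.idem x),
    h4 _ (InCorner.mul_mid hp.symm.idem hp.symm.idem x)]
  simp only [add_mul]

theorem commutator_sub_central {S : Type*} [Ring S] {s t a b : S} (ha : ∀ y, a * y = y * a)
    (hb : ∀ y, b * y = y * b) : (s - a) * (t - b) - (t - b) * (s - a) = s * t - t * s := by
  simp only [sub_mul, mul_sub]
  rw [ha t, ha b, hb s]
  abel

/-- A Lie lift is proper if it is the sum of a multiplicative lift and a central map. -/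
def IsProperLift (L : G →ₗ[R] PowerSeries G) : Prop :=
  ∃ D T : G →ₗ[R] PowerSeries G, (∀ x, PowerSeries.coeff 0 (D x) = x) ∧
    (∀ x y, D (x * y) = D x * D y) ∧ (∀ x y, T x * y = y * T x) ∧ L = D + T

variable {p q : G} {L : G →ₗ[R] PowerSeries G}

theorem IsLieLift.isProperLift_of_normalized (hp : IsPeircePair p q) (hL : IsLieLift L)
    (hc : L p * PowerSeries.C p = PowerSeries.C p * L p)
    (h2 : ∀ m, InCorner p q m → m + m = 0 → m = 0)
    (h2' : ∀ n, InCorner q p n → n + n = 0 → n = 0)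
    (hZp : CornerCenterLifts p) (hZq : CornerCenterLifts q)
    (hsf : CornerStronglyFaithful p q) (hne : ∃ m, InCorner p q m ∧ m ≠ 0) :
    IsProperLift L := by
  have hc' := hL.normalized_symm hp hc
  obtain ⟨T₁, hT₁, hT₁c, hT₁z, hT₁0⟩ :=
    hL.exists_central_part hp hc hZq (hsf.noCenter_left hp hne)
  obtain ⟨T₂, hT₂, hT₂c, hT₂z, hT₂0⟩ :=
    hL.exists_central_part hp.symm hc' hZp (hsf.noCenter_right hp hne)
  have hT : ∀ x y, (T₁ + T₂) x * y = y * (T₁ + T₂) x := fun x y => by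
    rw [LinearMap.add_apply, add_mul, mul_add, hT₁, hT₂]
  have hD0 : ∀ x, PowerSeries.coeff 0 ((L - (T₁ + T₂)) x) = x := fun x => by
    rw [LinearMap.sub_apply, LinearMap.add_apply, map_sub, map_add, hL.coeff_zero, hT₁0, hT₂0,
      add_zero, sub_zero]
  -- `T₁` is supported on `p G p` and `T₂` on `q G q`, so neither correction disturbs the other or
  -- the off-diagonal corners.
  have z₁ : ∀ r x, InCorner q r x → T₁ x = 0 := fun r x hx => hT₁z x (by
    rw [hx.mul_eq_zero_left hp.mul, zero_mul])
  have z₁' : ∀ r x, InCorner r q x → T₁ x = 0 := fun r x hx => hT₁z x (by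
    rw [mul_assoc, hx.mul_eq_zero_right hp.mul', mul_zero])
  have z₂ : ∀ r x, InCorner p r x → T₂ x = 0 := fun r x hx => hT₂z x (by
    rw [hx.mul_eq_zero_left hp.mul', zero_mul])
  have z₂' : ∀ r x, InCorner r p x → T₂ x = 0 := fun r x hx => hT₂z x (by
    rw [mul_assoc, hx.mul_eq_zero_right hp.mul, mul_zero])
  have hTpq : ∀ x, InCorner p q x → (T₁ + T₂) x = 0 := fun x hx => by
    rw [LinearMap.add_apply, z₁' p x hx, z₂ q x hx, add_zero]
  have hTqp : ∀ x, InCorner q p x → (T₁ + T₂) x = 0 := fun x hx => by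
    rw [LinearMap.add_apply, z₁ p x hx, z₂' q x hx, add_zero]
  refine ⟨L - (T₁ + T₂), T₁ + T₂, hD0, ?_, hT, (sub_add_cancel _ _).symm⟩
  refine map_mul_of_corners hp hD0 ?_ ?_ ?_ ?_ hT hTpq hTqp ?_ h2 hsf hne
  · intro x hx
    have := hT₁c x
    rwa [hx.eq_mid, ← sub_zero (L x - T₁ x), ← z₂ p x hx, sub_sub] at this
  · intro x hx
    rw [LinearMap.sub_apply, hTpq x hx, sub_zero]
    exact hL.offDiagonal hp hc h2' hx
  · intro x hx
    rw [LinearMap.sub_apply, hTqp x hx, sub_zero]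
    exact hL.offDiagonal hp.symm hc' h2 hx
  · intro x hx
    have := hT₂c x
    rwa [hx.eq_mid, ← sub_zero (L x - T₂ x), ← z₁ q x hx, sub_sub, add_comm (T₂ x)] at this
  · intro x y
    rw [LinearMap.sub_apply, sub_add_cancel, hL.map_commutator]
    exact (commutator_sub_central (hT x) (hT y)).symm

theorem IsLieLift.isProperLift (hp : IsPeircePair p q) (hL : IsLieLift L)
    (h2 : ∀ m, InCorner p q m → m + m = 0 → m = 0)
    (h2' : ∀ n, InCorner q p n → n + n = 0 → n = 0)
    (hZp : CornerCenterLifts p) (hZq : CornerCenterLifts q)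
    (hsf : CornerStronglyFaithful p q) (hne : ∃ m, InCorner p q m ∧ m ≠ 0) :
    IsProperLift L := by
  obtain ⟨u, v, huv, hvu, hu0, hv0, huc⟩ := exists_conj_commute hp (hL.coeff_zero p)
  let conj : PowerSeries G → PowerSeries G → PowerSeries G →ₗ[R] PowerSeries G := fun s t =>
    { toFun := fun x => s * x * t
      map_add' := fun x y => by rw [mul_add, add_mul]
      map_smul' := fun r x => by rw [mul_smul_comm, smul_mul_assoc, RingHom.id_apply] }
  have conj_apply : ∀ s t x, conj s t x = s * x * t := fun _ _ _ => rfl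
  have conj_mul : ∀ s t : PowerSeries G, t * s = 1 → ∀ x y,
      s * (x * y) * t = (s * x * t) * (s * y * t) := by
    intro s t hst x y
    rw [mul_assoc (s * x), ← mul_assoc t, ← mul_assoc t, hst, one_mul]
    simp only [mul_assoc]
  have hL' : IsLieLift ((conj v u).comp L) := by
    constructor
    · intro x
      rw [LinearMap.comp_apply, conj_apply, coeff_zero_mul_eq, coeff_zero_mul_eq, hu0, hv0,
        hL.coeff_zero, one_mul, mul_one]
    · intro x y
      simp only [LinearMap.comp_apply, conj_apply, hL.map_commutator]
      rw [mul_sub, sub_mul, conj_mul v u huv, conj_mul v u huv]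
  obtain ⟨D, T, hD0, hD, hT, hDT⟩ :=
    hL'.isProperLift_of_normalized hp huc h2 h2' hZp hZq hsf hne
  refine ⟨(conj u v).comp D, T, ?_, ?_, hT, ?_⟩
  · intro x
    rw [LinearMap.comp_apply, conj_apply, coeff_zero_mul_eq, coeff_zero_mul_eq, hu0, hv0, hD0,
      one_mul, mul_one]
  · intro x y
    simp only [LinearMap.comp_apply, conj_apply, hD]
    rw [conj_mul u v hvu]
  · ext1 x
    have e : v * L x * u = D x + T x := by
      have := congrArg (· x) hDT
      exact this
    have e' : u * (v * L x * u) * v = L x := by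
      rw [mul_assoc v, ← mul_assoc u, huv, one_mul, mul_assoc, huv, mul_one]
    -- Undoing the conjugation changes only `D`; the values of `T` are central and stay fixed.
    rw [LinearMap.add_apply, LinearMap.comp_apply, conj_apply, ← e', e, mul_add, add_mul,
      ← hT x u, mul_assoc (T x), huv, mul_one]

end Multiplicativity

/-! ### Passage between sequences of maps and power series. -/

section LHD

variable {R : Type u} {G : Type v} [CommRing R] [Ring G] [Algebra R G]

/-- Every Lie higher derivation is proper on an algebra with complementary idempotents `p`, `q`
such that the centers of `p G p` and `q G q` lift and `p G q` is strongly faithful. -/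
theorem hasLHDProperty_of_peircePair {p q : G} (hp : IsPeircePair p q)
    (h2 : ∀ m, InCorner p q m → m + m = 0 → m = 0)
    (h2' : ∀ n, InCorner q p n → n + n = 0 → n = 0)
    (hZp : CornerCenterLifts p) (hZq : CornerCenterLifts q)
    (hsf : CornerStronglyFaithful p q) (hne : ∃ m, InCorner p q m ∧ m ≠ 0) :
    HasLHDProperty R G := by
  intro L hL
  let S : G →ₗ[R] PowerSeries G :=
    { toFun := fun x => PowerSeries.mk fun k => L k x
      map_add' := fun x y => by ext k; simp
      map_smul' := fun r x => by ext k; simp }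
  have S_coeff : ∀ k x, PowerSeries.coeff k (S x) = L k x := fun k x =>
    PowerSeries.coeff_mk k fun k => L k x
  have hS : IsLieLift S := by
    constructor
    · intro x
      rw [S_coeff, hL.zero, LinearMap.id_apply]
    · intro x y
      ext k
      rw [S_coeff, hL.map_commutator, map_sub, PowerSeries.coeff_mul, PowerSeries.coeff_mul,
        ← Finset.Nat.sum_antidiagonal_swap (f := fun i =>
          PowerSeries.coeff i.1 (S y) * PowerSeries.coeff i.2 (S x)), ← Finset.sum_sub_distrib]
      simp only [S_coeff, Prod.fst_swap, Prod.snd_swap]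
  obtain ⟨D, T, hD0, hD, hT, hDT⟩ := hS.isProperLift hp h2 h2' hZp hZq hsf hne
  have hST : ∀ x, S x = D x + T x := fun x => congrArg (· x) hDT
  let c : ℕ → PowerSeries G →ₗ[R] G := fun k =>
    { toFun := fun f => PowerSeries.coeff k f
      map_add' := fun f g => map_add _ f g
      map_smul' := fun r f => by simp }
  have c_apply : ∀ k f, c k f = PowerSeries.coeff k f := fun _ _ => rfl
  refine ⟨hL, fun k => (c k).comp D, fun k => (c k).comp T, ⟨?_, ?_⟩, ?_, ?_, ?_⟩
  · ext x
    exact hD0 x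
  · intro k x y
    simp only [LinearMap.comp_apply, c_apply, hD, PowerSeries.coeff_mul]
  · intro k _ x
    exact coeff_mem_center (hT x) k
  · intro k _ x y
    -- `D` differs from `S` by central values, so both have the same commutators; both respect
    -- commutators, hence `T = S - D` kills them.
    have e : T (x * y - y * x) = 0 := by
      have hDS : ∀ x, D x = S x - T x := fun x => eq_sub_of_add_eq (hST x).symm
      rw [eq_sub_of_add_eq' (hST _).symm, hS.map_commutator, map_sub, hD, hD, hDS, hDS,
        commutator_sub_central (hT x) (hT y), sub_self]
    rw [LinearMap.comp_apply, e, map_zero]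
  · intro k _
    ext x
    rw [LinearMap.add_apply, LinearMap.comp_apply, LinearMap.comp_apply, ← map_add, ← hST,
      c_apply, S_coeff]

end LHD

/-! ### Translation to the generalized matrix algebra. -/

section GeneralizedMatrixAlgebraLHD

variable {R : Type u} {A : Type v} {B : Type w} {M : Type x} {N : Type y}
  [CommRing R] [Ring A] [Algebra R A] [Ring B] [Algebra R B]
  [AddCommGroup M] [Module R M] [Module A M] [Module Bᵐᵒᵖ M]
  [AddCommGroup N] [Module R N] [Module B N] [Module Aᵐᵒᵖ N]

namespace GenMatrixAlgebra

/-- The diagonal idempotent `(1, 0; 0, 0)`. -/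
def idemA (C : MoritaContext R A B M N) : GenMatrixAlgebra C := ⟨1, 0, 0, 0⟩

/-- The diagonal idempotent `(0, 0; 0, 1)`. -/
def idemB (C : MoritaContext R A B M N) : GenMatrixAlgebra C := ⟨0, 0, 0, 1⟩

variable (C : MoritaContext R A B M N)

@[simp] theorem idemA_a : (idemA C).a = 1 := rfl
@[simp] theorem idemA_m : (idemA C).m = 0 := rfl
@[simp] theorem idemA_n : (idemA C).n = 0 := rfl
@[simp] theorem idemA_b : (idemA C).b = 0 := rfl
@[simp] theorem idemB_a : (idemB C).a = 0 := rfl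
@[simp] theorem idemB_m : (idemB C).m = 0 := rfl
@[simp] theorem idemB_n : (idemB C).n = 0 := rfl
@[simp] theorem idemB_b : (idemB C).b = 1 := rfl

variable [SMulCommClass A Bᵐᵒᵖ M] [SMulCommClass B Aᵐᵒᵖ N]

theorem isPeircePair_idem : IsPeircePair (idemA C) (idemB C) where
  add := by ext <;> simp
  mul := by ext <;> simp
  mul' := by ext <;> simp

variable {C}

theorem inCorner_AA_iff {s : GenMatrixAlgebra C} :
    InCorner (idemA C) (idemA C) s ↔ s.m = 0 ∧ s.n = 0 ∧ s.b = 0 := by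
  constructor
  · rintro ⟨h1, h2⟩
    have e1 := congrArg GenMatrixAlgebra.n h1
    have e2 := congrArg GenMatrixAlgebra.b h1
    have e3 := congrArg GenMatrixAlgebra.m h2
    simp at e1 e2 e3
    exact ⟨e3.symm, e1.symm, e2.symm⟩
  · rintro ⟨h1, h2, h3⟩
    constructor <;> ext <;> simp [h1, h2, h3]

theorem inCorner_BB_iff {s : GenMatrixAlgebra C} :
    InCorner (idemB C) (idemB C) s ↔ s.a = 0 ∧ s.m = 0 ∧ s.n = 0 := by
  constructor
  · rintro ⟨h1, h2⟩
    have e1 := congrArg GenMatrixAlgebra.a h1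
    have e2 := congrArg GenMatrixAlgebra.m h1
    have e3 := congrArg GenMatrixAlgebra.n h2
    simp at e1 e2 e3
    exact ⟨e1.symm, e2.symm, e3.symm⟩
  · rintro ⟨h1, h2, h3⟩
    constructor <;> ext <;> simp [h1, h2, h3]

theorem inCorner_AB_iff {s : GenMatrixAlgebra C} :
    InCorner (idemA C) (idemB C) s ↔ s.a = 0 ∧ s.n = 0 ∧ s.b = 0 := by
  constructor
  · rintro ⟨h1, h2⟩
    have e1 := congrArg GenMatrixAlgebra.n h1
    have e2 := congrArg GenMatrixAlgebra.b h1
    have e3 := congrArg GenMatrixAlgebra.a h2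
    simp at e1 e2 e3
    exact ⟨e3.symm, e1.symm, e2.symm⟩
  · rintro ⟨h1, h2, h3⟩
    constructor <;> ext <;> simp [h1, h2, h3]

theorem inCorner_BA_iff {s : GenMatrixAlgebra C} :
    InCorner (idemB C) (idemA C) s ↔ s.a = 0 ∧ s.m = 0 ∧ s.b = 0 := by
  constructor
  · rintro ⟨h1, h2⟩
    have e1 := congrArg GenMatrixAlgebra.a h1
    have e2 := congrArg GenMatrixAlgebra.m h1
    have e3 := congrArg GenMatrixAlgebra.b h2
    simp at e1 e2 e3
    exact ⟨e1.symm, e2.symm, e3.symm⟩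
  · rintro ⟨h1, h2, h3⟩
    constructor <;> ext <;> simp [h1, h2, h3]

/-- The upper left entry lies in `Z(A)`, hence by (i) is that of a central matrix; compressing this
matrix by `idemA` recovers the given element. -/
theorem cornerCenterLifts_idemA
    (hA : projA C '' Set.center (GenMatrixAlgebra C) = Set.center A) :
    CornerCenterLifts (idemA C) := by
  intro s hs hcomm
  obtain ⟨h1, h2, h3⟩ := inCorner_AA_iff.1 hs
  have hs' : s.a ∈ Set.center A := by
    rw [Semigroup.mem_center_iff]
    intro a
    have := congrArg GenMatrixAlgebra.a (hcomm ⟨a, 0, 0, 0⟩ (inCorner_AA_iff.2 ⟨rfl, rfl, rfl⟩))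
    simpa using this.symm
  rw [← hA] at hs'
  obtain ⟨z, hz, hza⟩ := hs'
  have hza : z.a = s.a := hza
  exact ⟨z, hz, by ext <;> simp [h1, h2, h3, hza]⟩

theorem cornerCenterLifts_idemB
    (hB : projB C '' Set.center (GenMatrixAlgebra C) = Set.center B) :
    CornerCenterLifts (idemB C) := by
  intro s hs hcomm
  obtain ⟨h1, h2, h3⟩ := inCorner_BB_iff.1 hs
  have hs' : s.b ∈ Set.center B := by
    rw [Semigroup.mem_center_iff]
    intro b
    have := congrArg GenMatrixAlgebra.b (hcomm ⟨0, 0, 0, b⟩ (inCorner_BB_iff.2 ⟨rfl, rfl, rfl⟩))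
    simpa using this.symm
  rw [← hB] at hs'
  obtain ⟨z, hz, hzb⟩ := hs'
  have hzb : z.b = s.b := hzb
  exact ⟨z, hz, by ext <;> simp [h1, h2, h3, hzb]⟩

theorem cornerStronglyFaithful_AB (h : IsStronglyFaithful A B M) :
    CornerStronglyFaithful (idemA C) (idemB C) := by
  rcases h with ⟨h1, h2⟩ | ⟨h1, h2⟩
  · left
    constructor
    · intro s hs h0
      obtain ⟨e1, e2, e3⟩ := inCorner_BB_iff.1 hs
      have : s.b = 0 := h1 s.b fun m => by
        have := congrArg GenMatrixAlgebra.m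
          (h0 ⟨0, m, 0, 0⟩ (inCorner_AB_iff.2 ⟨rfl, rfl, rfl⟩))
        simpa using this
      ext <;> simp [*]
    · intro s t hs ht h0
      obtain ⟨e1, e2, e3⟩ := inCorner_AA_iff.1 hs
      obtain ⟨e4, e5, e6⟩ := inCorner_AB_iff.1 ht
      have := congrArg GenMatrixAlgebra.m h0
      simp only [mul_m, e1, smul_zero, add_zero, zero_m] at this
      exact (h2 _ _ this).imp (fun h => by ext <;> simp [*]) (fun h => by ext <;> simp [*])
  · right
    constructor
    · intro s hs h0
      obtain ⟨e1, e2, e3⟩ := inCorner_AA_iff.1 hs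
      have : s.a = 0 := h1 s.a fun m => by
        have := congrArg GenMatrixAlgebra.m
          (h0 ⟨0, m, 0, 0⟩ (inCorner_AB_iff.2 ⟨rfl, rfl, rfl⟩))
        simpa using this
      ext <;> simp [*]
    · intro s t hs ht h0
      obtain ⟨e1, e2, e3⟩ := inCorner_AB_iff.1 hs
      obtain ⟨e4, e5, e6⟩ := inCorner_BB_iff.1 ht
      have := congrArg GenMatrixAlgebra.m h0
      simp only [mul_m, e1, zero_smul, zero_add, zero_m] at this
      exact (h2 _ _ this).imp (fun h => by ext <;> simp [*]) (fun h => by ext <;> simp [*])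

theorem cornerStronglyFaithful_BA (h : IsStronglyFaithful B A N) :
    CornerStronglyFaithful (idemB C) (idemA C) := by
  rcases h with ⟨h1, h2⟩ | ⟨h1, h2⟩
  · left
    constructor
    · intro s hs h0
      obtain ⟨e1, e2, e3⟩ := inCorner_AA_iff.1 hs
      have : s.a = 0 := h1 s.a fun n => by
        have := congrArg GenMatrixAlgebra.n
          (h0 ⟨0, 0, n, 0⟩ (inCorner_BA_iff.2 ⟨rfl, rfl, rfl⟩))
        simpa using this
      ext <;> simp [*]
    · intro s t hs ht h0
      obtain ⟨e1, e2, e3⟩ := inCorner_BB_iff.1 hs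
      obtain ⟨e4, e5, e6⟩ := inCorner_BA_iff.1 ht
      have := congrArg GenMatrixAlgebra.n h0
      simp only [mul_n, e3, smul_zero, zero_add, zero_n] at this
      exact (h2 _ _ this).imp (fun h => by ext <;> simp [*]) (fun h => by ext <;> simp [*])
  · right
    constructor
    · intro s hs h0
      obtain ⟨e1, e2, e3⟩ := inCorner_BB_iff.1 hs
      have : s.b = 0 := h1 s.b fun n => by
        have := congrArg GenMatrixAlgebra.n
          (h0 ⟨0, 0, n, 0⟩ (inCorner_BA_iff.2 ⟨rfl, rfl, rfl⟩))
        simpa using this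
      ext <;> simp [*]
    · intro s t hs ht h0
      obtain ⟨e1, e2, e3⟩ := inCorner_BA_iff.1 hs
      obtain ⟨e4, e5, e6⟩ := inCorner_AA_iff.1 ht
      have := congrArg GenMatrixAlgebra.n h0
      simp only [mul_n, e3, zero_smul, add_zero, zero_n] at this
      exact (h2 _ _ this).imp (fun h => by ext <;> simp [*]) (fun h => by ext <;> simp [*])

theorem torsionFree_AB (hM : ∀ m : M, 2 • m = 0 → m = 0) (s : GenMatrixAlgebra C)
    (hs : InCorner (idemA C) (idemB C) s) (h : s + s = 0) : s = 0 := by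
  obtain ⟨e1, e2, e3⟩ := inCorner_AB_iff.1 hs
  have : s.m = 0 := hM _ (by rw [two_nsmul]; exact congrArg GenMatrixAlgebra.m h)
  ext <;> simp [*]

theorem torsionFree_BA (hN : ∀ n : N, 2 • n = 0 → n = 0) (s : GenMatrixAlgebra C)
    (hs : InCorner (idemB C) (idemA C) s) (h : s + s = 0) : s = 0 := by
  obtain ⟨e1, e2, e3⟩ := inCorner_BA_iff.1 hs
  have : s.n = 0 := hN _ (by rw [two_nsmul]; exact congrArg GenMatrixAlgebra.n h)
  ext <;> simp [*]

end GenMatrixAlgebra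

/-- A strongly faithful bimodule is nonzero unless all bimodules over the same rings vanish. -/
theorem IsStronglyFaithful.nontrivial {A : Type v} {B : Type w} {M : Type x} {N : Type y}
    [Ring A] [Ring B] [AddCommGroup M] [Module A M] [Module Bᵐᵒᵖ M]
    [AddCommGroup N] [Module B N] [Module Aᵐᵒᵖ N]
    (h : IsStronglyFaithful A B M) (hne : Nontrivial M ∨ Nontrivial N) : Nontrivial M := by
  rcases hne with hM | hN
  · exact hM
  -- If `M = 0`, the annihilator clause applied to 1 forces `B = 0` or `A = 0`, and then `N = 0`.
  by_contra hM
  rw [not_nontrivial_iff_subsingleton] at hM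
  obtain ⟨n, hn⟩ := exists_ne (0 : N)
  rcases h with ⟨h1, -⟩ | ⟨h1, -⟩
  · have : (1 : B) = 0 := h1 1 fun m => Subsingleton.elim _ _
    exact hn (by rw [← one_smul B n, this, zero_smul])
  · have : (1 : A) = 0 := h1 1 fun m => Subsingleton.elim _ _
    exact hn (by rw [← one_smul Aᵐᵒᵖ n, ← op_one, this, op_zero, zero_smul])

end GeneralizedMatrixAlgebraLHD
theorem mainTheorem8 {R : Type u} {A : Type v} {B : Type w} {M : Type x} {N : Type y}
    [CommRing R] [Ring A] [Algebra R A] [Ring B] [Algebra R B]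
    [AddCommGroup M] [Module R M] [Module A M] [Module Bᵐᵒᵖ M]
    [IsScalarTower R A M] [IsScalarTower R Bᵐᵒᵖ M] [SMulCommClass A Bᵐᵒᵖ M]
    [AddCommGroup N] [Module R N] [Module B N] [Module Aᵐᵒᵖ N]
    [IsScalarTower R B N] [IsScalarTower R Aᵐᵒᵖ N] [SMulCommClass B Aᵐᵒᵖ N]
    (C : MoritaContext R A B M N)
    (h_nonzero : Nontrivial M ∨ Nontrivial N)
    (hM : ∀ m : M, 2 • m = 0 → m = 0)
    (hN : ∀ n : N, 2 • n = 0 → n = 0)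
    (hA : GenMatrixAlgebra.projA C '' Set.center (GenMatrixAlgebra C) = Set.center A)
    (hB : GenMatrixAlgebra.projB C '' Set.center (GenMatrixAlgebra C) = Set.center B)
    (h_faithful : IsStronglyFaithful A B M ∨ IsStronglyFaithful B A N) :
    HasLHDProperty R (GenMatrixAlgebra C) := by
  have hp := GenMatrixAlgebra.isPeircePair_idem C
  have h2 := GenMatrixAlgebra.torsionFree_AB (C := C) hM
  have h2' := GenMatrixAlgebra.torsionFree_BA (C := C) hN
  have hZA := GenMatrixAlgebra.cornerCenterLifts_idemA hA
  have hZB := GenMatrixAlgebra.cornerCenterLifts_idemB hB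
  rcases h_faithful with h | h
  · have := h.nontrivial h_nonzero
    obtain ⟨m, hm⟩ := exists_ne (0 : M)
    exact hasLHDProperty_of_peircePair hp h2 h2' hZA hZB
      (GenMatrixAlgebra.cornerStronglyFaithful_AB h)
      ⟨⟨0, m, 0, 0⟩, GenMatrixAlgebra.inCorner_AB_iff.2 ⟨rfl, rfl, rfl⟩,
        fun e => hm (congrArg GenMatrixAlgebra.m e)⟩
  -- The hypotheses are symmetric in the two diagonal corners, so this case exchanges the
  -- idempotents.
  · have := h.nontrivial h_nonzero.symm
    obtain ⟨n, hn⟩ := exists_ne (0 : N)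
    exact hasLHDProperty_of_peircePair hp.symm h2' h2 hZB hZA
      (GenMatrixAlgebra.cornerStronglyFaithful_BA h)
      ⟨⟨0, 0, n, 0⟩, GenMatrixAlgebra.inCorner_BA_iff.2 ⟨rfl, rfl, rfl⟩,
        fun e => hn (congrArg GenMatrixAlgebra.n e)⟩
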